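/- **Lemma (Lightlike coordinates).** Let $M$ be a smooth $4$-dimensional manifold, let $A\subset TM\setminus\mathbf 0$ be open, connected and conic ($\lambda v\in A$ for $v\in A$, $\lambda>0$), with smooth boundary in $TM\setminus\mathbf 0$ and with $A\cap T_pM\neq\emptyset$ for every $p\in M$, and let $\bar A$ be its closure in $TM\setminus\mathbf 0$. Let $L\colon\bar A\to[0,\infty)$ be a Finsler spacetime structure: $L$ is smooth (i.e. it extends to a smooth function on an open neighbourhood of $\bar A$), $L(\lambda v)=\lambda^2L(v)$ for $\lambda>0$, the boundary of $\bar A$ in $TM\setminus\mathbf 0$ is $L^{-1}(0)$, and for each $v\in\bar A$ the fundamental tensor $$g_v(u,w)=\tfrac12\,\tfrac{\partial^2}{\partial s\,\partial t}L(v+tu+sw)\Big|_{t=s=0},\qquad u,w\in T_{\pi(v)}M,$$ has signature $(+,-,-,-)$. Let $f$ be a smooth function on an open set $\mathscr U\subseteq M$ that has a gradient $N=\nabla f$ there, i.e. a smooth vector field $N$ on $\mathscr U$ with values in $\bar A$ such that $g_N(N,X)=df(X)$ for all $X$. Suppose $N$ is lightlike: $N$ vanishes nowhere and $L(N)=0$.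 Then around every point of $\mathscr U$ there are smooth coordinates $(x^0,x^1,x^2,x^3)$, defined on an open subset of $\mathscr U$, such that throughout their domain $N=\partial_0$ and, with $g_{ij}(N)=g_N(\partial_i,\partial_j)$, $$(g_{ij}(N))=\begin{pmatrix}0&1&0&0\\1&g_{11}(N)&g_{12}(N)&g_{13}(N)\\0&g_{21}(N)&h_{22}&h_{23}\\0&g_{31}(N)&h_{32}&h_{33}\end{pmatrix},$$ where the symmetric $2\times2$ matrix $(h_{ij})$ is negative definite. The same holds in the opposite signature convention, i.e. when $L\colon\bar A\to(-\infty,0]$ is such that $-L$ satisfies the assumptions above (so that $g_v$ has signature $(-,+,+,+)$), with $g$, $\nabla f$ and $g_{ij}(N)$ still formed from $L$; in that case $(h_{ij})$ is positive definite. -/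

import Mathlib

open scoped Manifold ContDiff

noncomputable section

/-- The model space `ℝ⁴` of a four-dimensional manifold. -/
abbrev R4 : Type := EuclideanSpace ℝ (Fin 4)

section FinslerSpacetime

variable {M : Type*} [TopologicalSpace M] [ChartedSpace R4 M]

/-- The slit tangent bundle `TM ∖ 0`. -/
def slitTangent (M : Type*) [TopologicalSpace M] [ChartedSpace R4 M] :
    Set (TangentBundle (𝓡 4) M) :=
  {v | v.2 ≠ 0}

/-- The fundamental tensor
`g_v(u, w) = (1/2) ∂²/∂s∂t L(v + t u + s w)` at `t = s = 0`, for `v, u, w ∈ T_pM`. -/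
def fundTensor (L : TangentBundle (𝓡 4) M → ℝ) {p : M} (v u w : TangentSpace (𝓡 4) p) : ℝ :=
  (1 / 2) * deriv (fun s : ℝ => deriv (fun t : ℝ => L ⟨p, v + t • u + s • w⟩) 0) 0

/-- `g_v` has signature `(+,-,-,-)`: there is a basis of `T_pM` in which its Gram matrix is
`diag(1,-1,-1,-1)`. -/
def HasSignaturePMMM (L : TangentBundle (𝓡 4) M → ℝ) {p : M} (v : TangentSpace (𝓡 4) p) : Prop :=
  ∃ b : Module.Basis (Fin 4) ℝ (TangentSpace (𝓡 4) p), ∀ i j : Fin 4,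
    fundTensor L v (b i) (b j) = Matrix.diagonal ![(1 : ℝ), -1, -1, -1] i j

variable [IsManifold (𝓡 4) ∞ M]

/-- The closure `Ā` of `A` in the slit tangent bundle. -/
def slitClosure (A : Set (TangentBundle (𝓡 4) M)) : Set (TangentBundle (𝓡 4) M) :=
  closure A ∩ slitTangent M

/-- `A` has smooth boundary in `TM ∖ 0`: near each boundary point, `A` is the positivity set of a
smooth function with nonvanishing differential at that point. -/
def HasSmoothBoundary (A : Set (TangentBundle (𝓡 4) M)) : Prop :=
  ∀ v ∈ frontier A ∩ slitTangent M, ∃ W : Set (TangentBundle (𝓡 4) M), IsOpen W ∧ v ∈ W ∧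
    ∃ ρ : TangentBundle (𝓡 4) M → ℝ, ContMDiffOn (𝓡 4).tangent 𝓘(ℝ, ℝ) ∞ ρ W ∧
      mfderiv (𝓡 4).tangent 𝓘(ℝ, ℝ) ρ v ≠ 0 ∧ A ∩ W = {w ∈ W | 0 < ρ w}

/-- `(M, L)` is a Finsler spacetime with cone domain `A`, in the convention that `L > 0` on `A` and
the signature is `(+,-,-,-)`.

The metric is a function on `Ā`; it is represented by a function `L` on `TM` whose values away from
`Ā` are irrelevant, except that, as usual for smooth functions on a domain with smooth boundary, `L`
is smooth on some open neighbourhood of `Ā`. Every `v ∈ Ā` is a limit of points of the open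
set `A`, so the fundamental tensor at `v` does not depend on the values of `L` off `Ā`. -/
structure IsFinslerSpacetime (A : Set (TangentBundle (𝓡 4) M))
    (L : TangentBundle (𝓡 4) M → ℝ) : Prop where
  subset_slit : A ⊆ slitTangent M
  isOpen : IsOpen A
  isConnected : IsConnected A
  conic : ∀ (p : M) (v : TangentSpace (𝓡 4) p) (c : ℝ), 0 < c →
    (⟨p, v⟩ : TangentBundle (𝓡 4) M) ∈ A → (⟨p, c • v⟩ : TangentBundle (𝓡 4) M) ∈ A
  fiber_nonempty : ∀ p : M, ∃ v : TangentSpace (𝓡 4) p, (⟨p, v⟩ : TangentBundle (𝓡 4) M) ∈ A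
  smooth_boundary : HasSmoothBoundary A
  smooth : ∃ O : Set (TangentBundle (𝓡 4) M), IsOpen O ∧ slitClosure A ⊆ O ∧
    ContMDiffOn (𝓡 4).tangent 𝓘(ℝ, ℝ) ∞ L O
  nonneg : ∀ v ∈ slitClosure A, 0 ≤ L v
  homogeneous : ∀ (p : M) (v : TangentSpace (𝓡 4) p) (c : ℝ), 0 < c →
    (⟨p, v⟩ : TangentBundle (𝓡 4) M) ∈ slitClosure A → L ⟨p, c • v⟩ = c ^ 2 * L ⟨p, v⟩
  signature : ∀ (p : M) (v : TangentSpace (𝓡 4) p),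
    (⟨p, v⟩ : TangentBundle (𝓡 4) M) ∈ slitClosure A → HasSignaturePMMM L v
  lightcone : frontier (slitClosure A) ∩ slitTangent M = {v ∈ slitClosure A | L v = 0}

/-- `N` is the gradient of `f` with respect to `L` on the open set `U`: it is a smooth vector
field on `U` with values in `Ā`, and `g_N(N, X) = df(X)` for all `X`. -/
structure IsGradientOn (A : Set (TangentBundle (𝓡 4) M)) (L : TangentBundle (𝓡 4) M → ℝ)
    (f : M → ℝ) (U : Set M) (N : (p : M) → TangentSpace (𝓡 4) p) : Prop where
  smooth : ContMDiffOn (𝓡 4) (𝓡 4).tangent ∞ (fun p => (⟨p, N p⟩ : TangentBundle (𝓡 4) M)) U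
  admissible : ∀ p ∈ U, (⟨p, N p⟩ : TangentBundle (𝓡 4) M) ∈ slitClosure A
  metric_eq : ∀ p ∈ U, ∀ X : TangentSpace (𝓡 4) p,
    fundTensor L (N p) (N p) X = mfderiv (𝓡 4) 𝓘(ℝ, ℝ) f p X

/-- The vector field `N` is lightlike on `U`: nowhere vanishing, with `L(N) = 0`. -/
def IsLightlikeOn (L : TangentBundle (𝓡 4) M → ℝ) (U : Set M)
    (N : (p : M) → TangentSpace (𝓡 4) p) : Prop :=
  ∀ p ∈ U, N p ≠ 0 ∧ L ⟨p, N p⟩ = 0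

/-- The coordinate vector `∂_i` at the point `q` of the chart `φ`, i.e. `d(φ⁻¹)_{φ(q)}(e_i)`. -/
def coordVec (φ : OpenPartialHomeomorph M R4) (i : Fin 4) (q : M) : TangentSpace (𝓡 4) q :=
  mfderiv (𝓡 4) (𝓡 4) φ.symm (φ q) (EuclideanSpace.single i (1 : ℝ))

/-- The matrix `g_{ij}(N) = g_N(∂_i, ∂_j)` of `g_N` at `q` in the chart `φ`. -/
def metricMatrix (L : TangentBundle (𝓡 4) M → ℝ) (N : (p : M) → TangentSpace (𝓡 4) p)
    (φ : OpenPartialHomeomorph M R4) (q : M) : Matrix (Fin 4) (Fin 4) ℝ :=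
  Matrix.of fun i j => fundTensor L (N q) (coordVec φ i q) (coordVec φ j q)

/-- The lower right block `h_{ij}`, `i, j ∈ {2, 3}`. -/
def transverseBlock (G : Matrix (Fin 4) (Fin 4) ℝ) : Matrix (Fin 2) (Fin 2) ℝ :=
  !![G 2 2, G 2 3; G 3 2, G 3 3]

/-- `φ` is a smooth chart of `M` around `p`, inside `U`, in which `N = ∂_0` and the matrix of `g_N`
has first row and first column `(0, 1, 0, 0)` throughout. -/
structure IsLightlikeChart (L : TangentBundle (𝓡 4) M → ℝ) (U : Set M)
    (N : (p : M) → TangentSpace (𝓡 4) p) (p : M) (φ : OpenPartialHomeomorph M R4) : Prop where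
  mem_atlas : φ ∈ IsManifold.maximalAtlas (𝓡 4) ∞ M
  mem_source : p ∈ φ.source
  source_subset : φ.source ⊆ U
  field_eq : ∀ q ∈ φ.source, N q = coordVec φ 0 q
  matrix_eq : ∀ q ∈ φ.source,
    let G := metricMatrix L N φ q
    G = !![0, 1, 0, 0;
           1, G 1 1, G 1 2, G 1 3;
           0, G 2 1, G 2 2, G 2 3;
           0, G 3 1, G 3 2, G 3 3]

end FinslerSpacetime

end

open scoped Topology Matrix
open Set Filter Metric

/-!
Euler's identity `g_N(N, N) = L(N) = 0` says that `f` is constant along its own gradient `N`. Since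
`N` and `df` vanish nowhere, `N` and `f` can be straightened at once: on a slice transverse to
`N`, itself mapped so that `f` becomes affine, follow the flow of `N`. In the resulting coordinates
`N = ∂_0` and `f - f(p) = x^1`, so that `df = g_N(N, ·)` is the first row `(0, 1, 0, 0)` of the
matrix of `g_N`. The block `h` is the Gram matrix of `∂_2, ∂_3`, which lie in `N^⊥` and are
independent modulo `N`; as `N` is null, a form of signature `(+,-,-,-)` is negative definite on
`N^⊥ / ℝN`.

The flow is obtained, jointly smooth in time and initial value, from the implicit function theorem
applied to the Picard equation in the Banach space of continuous curves.
-/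

section InverseFunction

variable {E F G : Type*} [NormedAddCommGroup E] [NormedSpace ℝ E] [CompleteSpace E]
  [NormedAddCommGroup F] [NormedSpace ℝ F] [NormedAddCommGroup G] [NormedSpace ℝ G]

/- Smoothness is assumed near `a`: `ContDiffAt ℝ ∞ f a` alone would only bound the order of
differentiability away from `a` on neighbourhoods that shrink with the order. -/
theorem exists_openPartialHomeomorph_contDiffAt {f : E → F} {a : E}
    (hf : ∀ᶠ x in 𝓝 a, ContDiffAt ℝ ∞ f x) {f' : E ≃L[ℝ] F}
    (hf' : HasFDerivAt f (f' : E →L[ℝ] F) a) {s : Set E} (hs : s ∈ 𝓝 a) :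
    ∃ e : OpenPartialHomeomorph E F, a ∈ e.source ∧ ⇑e = f ∧ e.source ⊆ s ∧
      (∀ x ∈ e.source, ContDiffAt ℝ ∞ f x) ∧ ∀ y ∈ e.target, ContDiffAt ℝ ∞ e.symm y := by
  have hfa : ContDiffAt ℝ ∞ f a := hf.self_of_nhds
  have hn : (∞ : WithTop ℕ∞) ≠ 0 := by simp
  have hinv : ∀ᶠ x in 𝓝 a, fderiv ℝ f x ∈ range ((↑) : (E ≃L[ℝ] F) → E →L[ℝ] F) := by
    apply (hfa.fderiv_right (m := 0) (by simp)).continuousAt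
    rw [hf'.fderiv]
    exact ContinuousLinearEquiv.nhds f'
  obtain ⟨W, hW, hWo, haW⟩ := _root_.mem_nhds_iff.1 ((hf.and hinv).and hs)
  let e := (hfa.toOpenPartialHomeomorph f hf' hn).restrOpen W hWo
  refine ⟨e, ⟨hfa.mem_toOpenPartialHomeomorph_source hf' hn, haW⟩, rfl, fun x hx => (hW hx.2).2,
    fun x hx => (hW hx.2).1.1, fun y hy => ?_⟩
  obtain ⟨⟨hsmooth, g, hg⟩, -⟩ := hW (e.map_target hy).2
  exact e.contDiffAt_symm hy (hg ▸ (hsmooth.differentiableAt hn).hasFDerivAt) hsmooth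

theorem exists_contDiffAt_implicitFunction [CompleteSpace F] {f : E × F → G} {a : E} {b : F}
    (hf : ∀ᶠ q in 𝓝 (a, b), ContDiffAt ℝ ∞ f q) {f' : F ≃L[ℝ] G}
    (hf' : HasFDerivAt (fun y => f (a, y)) (f' : F →L[ℝ] G) b) :
    ∃ g : E → F, g a = b ∧ ∀ᶠ x in 𝓝 a, ContDiffAt ℝ ∞ g x ∧ f (x, g x) = f (a, b) := by
  have hfab := (hf.self_of_nhds.differentiableAt (by simp)).hasFDerivAt
  have hf'_eq : ∀ y, f' y = fderiv ℝ f (a, b) (0, y) := by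
    simpa using DFunLike.congr_fun
      (hf'.unique (hfab.comp b ((hasFDerivAt_const a b).prodMk (hasFDerivAt_id b))))
  let D : (E × F) ≃L[ℝ] E × G :=
    (ContinuousLinearEquiv.refl ℝ E).skewProd f' (fderiv ℝ f (a, b) ∘L .inl ℝ E F)
  have hD : HasFDerivAt (fun q : E × F => (q.1, f q)) (D : E × F →L[ℝ] E × G) (a, b) := by
    refine (hasFDerivAt_fst.prodMk hfab).congr_fderiv ?_
    ext q <;> simp [D, hf'_eq, Prod.mk_zero_zero]
  obtain ⟨e, hab, he, -, -, hsymm⟩ := exists_openPartialHomeomorph_contDiffAt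
    (hf.mono fun q hq => contDiffAt_fst.prodMk hq) hD univ_mem
  have hslice : ContDiff ℝ ∞ fun x : E => (x, f (a, b)) := by fun_prop
  refine ⟨fun x => (e.symm (x, f (a, b))).2, ?_, ?_⟩
  · simpa only [he] using congrArg Prod.snd (e.left_inv hab)
  · have htarget : ∀ᶠ x in 𝓝 a, (x, f (a, b)) ∈ e.target :=
      hslice.continuous.continuousAt.eventually
        (e.open_target.mem_nhds (by simpa [he] using e.map_source hab))
    filter_upwards [htarget] with x hx
    refine ⟨contDiffAt_snd.comp x ((hsymm _ hx).comp x hslice.contDiffAt), ?_⟩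
    have hright := e.right_inv hx
    rw [he, Prod.ext_iff] at hright
    convert hright.2
    exact hright.1.symm

end InverseFunction

section Postcomposition

universe u

variable {X : Type*} [TopologicalSpace X] [CompactSpace X]

/-- Pointwise application of a continuous family of linear maps to a continuous map. -/
noncomputable def pointwiseApply (X : Type*) [TopologicalSpace X] [CompactSpace X]
    (E F : Type*) [NormedAddCommGroup E] [NormedSpace ℝ E] [NormedAddCommGroup F]
    [NormedSpace ℝ F] : C(X, E →L[ℝ] F) →L[ℝ] C(X, E) →L[ℝ] C(X, F) :=
  LinearMap.mkContinuous₂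
    (LinearMap.mk₂ ℝ (fun (A : C(X, E →L[ℝ] F)) (y : C(X, E)) =>
        (⟨fun t => A t (y t), by fun_prop⟩ : C(X, F)))
      (fun _ _ _ => by ext; simp) (fun _ _ _ => by ext; simp)
      (fun _ _ _ => by ext; simp) (fun _ _ _ => by ext; simp)) 1
    (fun A y => by
      rw [ContinuousMap.norm_le _ (by positivity), one_mul]
      exact fun t => (A t).le_of_opNorm_le_of_le (A.norm_coe_le_norm t) (y.norm_coe_le_norm t))

@[simp]
theorem pointwiseApply_apply {E F : Type*} [NormedAddCommGroup E] [NormedSpace ℝ E]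
    [NormedAddCommGroup F] [NormedSpace ℝ F] (A : C(X, E →L[ℝ] F)) (y : C(X, E)) (t : X) :
    pointwiseApply X E F A y t = A t (y t) := rfl

/- By compactness, `z ↦ v' ∘ z` is continuous for the uniform norm, so the mean value inequality on
the segments `[y t, z t]` gives a bound that is uniform in `t`. -/
theorem hasFDerivAt_continuousMap_comp {E F : Type*} [NormedAddCommGroup E] [NormedSpace ℝ E]
    [NormedAddCommGroup F] [NormedSpace ℝ F] {v : C(E, F)} {v' : C(E, E →L[ℝ] F)}
    (hv : ∀ x, HasFDerivAt v (v' x) x) (y : C(X, E)) :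
    HasFDerivAt (fun z : C(X, E) => v.comp z) (pointwiseApply X E F (v'.comp y)) y := by
  rw [hasFDerivAt_iff_isLittleO, Asymptotics.isLittleO_iff]
  intro c hc
  have hcont := (ContinuousMap.continuous_postcomp (X := X) v').continuousAt (x := y)
  obtain ⟨δ, hδ, hball⟩ := (Metric.continuousAt_iff (α := C(X, E))
    (β := C(X, E →L[ℝ] F))).1 hcont c hc
  filter_upwards [Metric.ball_mem_nhds y hδ] with z hz
  rw [ContinuousMap.norm_le _ (by positivity)]
  intro t
  have hsegment : ∀ w ∈ segment ℝ (y t) (z t), ‖v' w - v' (y t)‖ ≤ c := by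
    rintro w ⟨a, b, ha, hb, hab, rfl⟩
    have hmem : a • y + b • z ∈ ball y δ := convex_ball y δ (mem_ball_self hδ) hz ha hb hab
    rw [← dist_eq_norm]
    exact (ContinuousMap.dist_apply_le_dist (f := v'.comp (a • y + b • z))
      (g := v'.comp y) t).trans (hball hmem).le
  calc ‖v (z t) - v (y t) - v' (y t) (z t - y t)‖
      ≤ c * ‖z t - y t‖ :=
        (convex_segment (y t) (z t)).norm_image_sub_le_of_norm_hasFDerivWithin_le' (fun w _ =>
          (hv w).hasFDerivWithinAt) hsegment (left_mem_segment ℝ _ _) (right_mem_segment ℝ _ _)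
    _ ≤ c * ‖z - y‖ := by
      gcongr
      exact ContinuousMap.norm_coe_le_norm (z - y) t

theorem contDiff_nat_continuousMap_comp {E : Type u} [NormedAddCommGroup E] [NormedSpace ℝ E]
    (n : ℕ) : ∀ {F : Type u} [NormedAddCommGroup F] [NormedSpace ℝ F] {v : C(E, F)},
      ContDiff ℝ n v → ContDiff ℝ n (fun z : C(X, E) => v.comp z) := by
  induction n with
  | zero => exact fun {F} _ _ v _ => contDiff_zero.2 (ContinuousMap.continuous_postcomp v)
  | succ n ih =>
    intro F _ _ v hv
    obtain ⟨v', hv', hderiv⟩ := contDiff_succ_iff_hasFDerivAt.1 hv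
    let w : C(E, E →L[ℝ] F) := ⟨v', hv'.continuous⟩
    refine contDiff_succ_iff_hasFDerivAt.2 ⟨fun y => pointwiseApply X E F (w.comp y), ?_,
      hasFDerivAt_continuousMap_comp (v' := w) hderiv⟩
    exact (pointwiseApply X E F).contDiff.comp (ih (v := w) hv')

theorem contDiff_continuousMap_comp {E F : Type u} [NormedAddCommGroup E] [NormedSpace ℝ E]
    [NormedAddCommGroup F] [NormedSpace ℝ F] {v : C(E, F)} (hv : ContDiff ℝ ∞ v) :
    ContDiff ℝ ∞ (fun z : C(X, E) => v.comp z) :=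
  contDiff_infty.2 fun n => contDiff_nat_continuousMap_comp n (contDiff_infty.1 hv n)

end Postcomposition

section Primitive

theorem intervalIntegrable_IccExtend {E : Type*} [NormedAddCommGroup E]
    (y : C(Icc (0 : ℝ) 1, E)) (a b : ℝ) :
    IntervalIntegrable (IccExtend zero_le_one y) MeasureTheory.volume a b :=
  y.continuous.Icc_extend'.intervalIntegrable a b

variable {E : Type*} [NormedAddCommGroup E] [NormedSpace ℝ E]

/-- The primitive of a continuous curve on the unit interval that vanishes at `0`. The extension of
the curve by constants serves only to write the integral over `[0, s]` as an interval integral. -/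
noncomputable def primitiveCLM (E : Type*) [NormedAddCommGroup E] [NormedSpace ℝ E] :
    C(Icc (0 : ℝ) 1, E) →L[ℝ] C(Icc (0 : ℝ) 1, E) :=
  LinearMap.mkContinuous
    { toFun := fun y => ⟨fun s => ∫ r in (0 : ℝ)..s, IccExtend zero_le_one y r,
        (intervalIntegral.continuous_primitive (intervalIntegrable_IccExtend y) 0).comp
          continuous_subtype_val⟩
      map_add' := fun y z => by
        ext s
        exact intervalIntegral.integral_add (intervalIntegrable_IccExtend y _ _)
          (intervalIntegrable_IccExtend z _ _)
      map_smul' := fun c y => by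
        ext s
        exact intervalIntegral.integral_smul c _ } 1
    (fun y => by
      rw [ContinuousMap.norm_le _ (by positivity)]
      intro s
      refine (intervalIntegral.norm_integral_le_of_norm_le_const (C := ‖y‖)
        fun r _ => y.norm_coe_le_norm _).trans ?_
      rw [sub_zero, abs_of_nonneg s.2.1, mul_comm]
      gcongr
      exact s.2.2)

theorem primitiveCLM_apply (y : C(Icc (0 : ℝ) 1, E)) (s : Icc (0 : ℝ) 1) :
    primitiveCLM E y s = ∫ r in (0 : ℝ)..s, IccExtend zero_le_one y r := rfl

variable [CompleteSpace E]

theorem hasDerivWithinAt_primitiveCLM (y : C(Icc (0 : ℝ) 1, E)) (s : Icc (0 : ℝ) 1) :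
    HasDerivWithinAt (IccExtend zero_le_one (primitiveCLM E y)) (y s) (Icc 0 1) s := by
  have hcont : Continuous (IccExtend zero_le_one y) := y.continuous.Icc_extend'
  have hderiv := (hcont.integral_hasStrictDerivAt 0 (s : ℝ)).hasDerivAt.hasDerivWithinAt
    (s := Icc (0 : ℝ) 1)
  rw [IccExtend_val] at hderiv
  refine hderiv.congr_of_mem (fun r hr => ?_) s.2
  rw [IccExtend_of_mem _ _ hr, primitiveCLM_apply]

theorem eq_primitiveCLM_of_hasDerivWithinAt {g : ℝ → E} {y : C(Icc (0 : ℝ) 1, E)} (hg₀ : g 0 = 0)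
    (hg : ∀ s : Icc (0 : ℝ) 1, HasDerivWithinAt g (y s) (Icc 0 1) s) (s : Icc (0 : ℝ) 1) :
    g s = primitiveCLM E y s := by
  have hP := hasDerivWithinAt_primitiveCLM y
  have hg_eq : EqOn g (IccExtend zero_le_one (primitiveCLM E y)) (Icc 0 1) := by
    refine eq_of_derivWithin_eq (fun r hr => (hg ⟨r, hr⟩).differentiableWithinAt)
      (fun r hr => (hP ⟨r, hr⟩).differentiableWithinAt) (fun r hr => ?_) ?_
    · have hunique := uniqueDiffOn_Icc_zero_one r (Ico_subset_Icc_self hr)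
      rw [(hg ⟨r, Ico_subset_Icc_self hr⟩).derivWithin hunique,
        (hP ⟨r, Ico_subset_Icc_self hr⟩).derivWithin hunique]
    · rw [hg₀, IccExtend_left]
      simp [primitiveCLM_apply]
  rw [hg_eq s.2, IccExtend_val]

end Primitive

section Flow

variable {E : Type*} [NormedAddCommGroup E] [NormedSpace ℝ E]

/-- `Φ (t, x)` is a smooth local flow of the vector field `v` for `(t, x)` near `(0, x₀)`. -/
structure IsSmoothLocalFlowAt (v : E → E) (Φ : ℝ × E → E) (x₀ : E) : Prop where
  contDiffAt : ∀ᶠ z in 𝓝 ((0 : ℝ), x₀), ContDiffAt ℝ ∞ Φ z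
  initial : ∀ᶠ x in 𝓝 x₀, Φ (0, x) = x
  hasDerivAt : ∀ᶠ z in 𝓝 ((0 : ℝ), x₀), HasDerivAt (fun t => Φ (t, z.2)) (v (Φ z)) z.1

/-- The curve on the unit interval `s ↦ y(s) - x - t ∫₀ˢ v(y)`, with `z = (t, x)`: it vanishes if
and only if `y(s)` is the integral curve of `v` through `x` at time `s t`. -/
noncomputable def picardResidual (v : C(E, E)) (q : (ℝ × E) × C(Icc (0 : ℝ) 1, E)) :
    C(Icc (0 : ℝ) 1, E) :=
  q.2 - (ContinuousLinearMap.const ℝ (Icc (0 : ℝ) 1) q.1.2 + q.1.1 • primitiveCLM E (v.comp q.2))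

theorem contDiff_picardResidual {v : C(E, E)} (hv : ContDiff ℝ ∞ v) :
    ContDiff ℝ ∞ (picardResidual v) := by
  have hP : ContDiff ℝ ∞ fun q : (ℝ × E) × C(Icc (0 : ℝ) 1, E) => primitiveCLM E (v.comp q.2) :=
    (primitiveCLM E).contDiff.comp ((contDiff_continuousMap_comp hv).comp contDiff_snd)
  unfold picardResidual
  fun_prop

theorem eq_variation_of_hasDerivAt {v : C(E, E)} {v' : C(E, E →L[ℝ] E)}
    (hv : ∀ x, HasFDerivAt v (v' x) x) {Y : ℝ × E → C(Icc (0 : ℝ) 1, E)} {z : ℝ × E}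
    (hY : ∀ᶠ z' in 𝓝 z, picardResidual v (z', Y z') = 0) {w : C(Icc (0 : ℝ) 1, E)}
    (hw : HasDerivAt (fun t => Y (t, z.2)) w z.1) :
    w = primitiveCLM E (v.comp (Y z)) +
      z.1 • primitiveCLM E (pointwiseApply _ E E (v'.comp (Y z)) w) := by
  have hv_deriv : HasDerivAt (fun t => v.comp (Y (t, z.2)))
      (pointwiseApply _ E E (v'.comp (Y z)) w) z.1 :=
    HasFDerivAt.comp_hasDerivAt (f := fun t => Y (t, z.2)) z.1
      (hasFDerivAt_continuousMap_comp hv (Y z)) hw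
  have hrhs := ((hasDerivAt_id z.1).smul
    ((primitiveCLM E).hasFDerivAt.comp_hasDerivAt z.1 hv_deriv)).const_add
      (ContinuousLinearMap.const ℝ (Icc (0 : ℝ) 1) z.2)
  have hslice : ContinuousAt (fun t : ℝ => (t, z.2)) z.1 := by fun_prop
  have hY_eq : (fun t => Y (t, z.2)) =ᶠ[𝓝 z.1] fun t =>
      ContinuousLinearMap.const ℝ (Icc (0 : ℝ) 1) z.2 + t • primitiveCLM E (v.comp (Y (t, z.2))) :=
    (hslice.eventually hY).mono fun t ht => sub_eq_zero.1 ht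
  simpa [add_comm] using hw.unique (hrhs.congr_of_eventuallyEq hY_eq)

theorem eventually_norm_variation_lt_one (v' : C(E, E →L[ℝ] E)) {x₀ : E}
    {Y : ℝ × E → C(Icc (0 : ℝ) 1, E)} (hY : ContinuousAt Y (0, x₀)) :
    ∀ᶠ z in 𝓝 ((0 : ℝ), x₀),
      ‖z.1‖ * ‖primitiveCLM E ∘L pointwiseApply _ E E (v'.comp (Y z))‖ < 1 := by
  have hv'Y : ContinuousAt (fun z => v'.comp (Y z)) (0, x₀) :=
    (ContinuousMap.continuous_postcomp v').continuousAt.comp hY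
  have hcont : ContinuousAt (fun z : ℝ × E =>
      ‖z.1‖ * ‖primitiveCLM E ∘L pointwiseApply _ E E (v'.comp (Y z))‖) (0, x₀) :=
    continuousAt_fst.norm.mul (((ContinuousLinearMap.compL ℝ _ _ _ (primitiveCLM E)).continuous.comp
      (pointwiseApply (Icc (0 : ℝ) 1) E E).continuous).continuousAt.comp hv'Y).norm
  refine hcont.eventually_lt continuousAt_const ?_
  simp

variable [CompleteSpace E]

/- The rescaled velocity `s ↦ s v(y(s))` solves the same linear integral equation as `w`. -/
theorem apply_one_eq_of_variation {v : C(E, E)} {v' : C(E, E →L[ℝ] E)}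
    (hv : ∀ x, HasFDerivAt v (v' x) x) {t : ℝ} {x : E} {y w : C(Icc (0 : ℝ) 1, E)}
    (hy : picardResidual v ((t, x), y) = 0)
    (hw : w = primitiveCLM E (v.comp y) +
      t • primitiveCLM E (pointwiseApply _ E E (v'.comp y) w))
    (hsmall : ‖t‖ * ‖primitiveCLM E ∘L pointwiseApply _ E E (v'.comp y)‖ < 1) :
    w 1 = v (y 1) := by
  have hy_apply : ∀ s, y s = x + t • primitiveCLM E (v.comp y) s := fun s => by
    simpa using DFunLike.congr_fun (sub_eq_zero.1 hy) s
  have hy_deriv (s : Icc (0 : ℝ) 1) :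
      HasDerivWithinAt (IccExtend zero_le_one y) (t • v (y s)) (Icc 0 1) s :=
    (((hasDerivWithinAt_primitiveCLM (v.comp y) s).const_smul t).const_add x).congr_of_mem
      (fun r _ => hy_apply _) s.2
  let z : C(Icc (0 : ℝ) 1, E) := ⟨fun s => (s : ℝ) • v (y s), by fun_prop⟩
  have hz : z = primitiveCLM E (v.comp y) +
      t • primitiveCLM E (pointwiseApply _ E E (v'.comp y) z) := by
    rw [← (primitiveCLM E).map_smul, ← (primitiveCLM E).map_add]
    ext s
    refine (congrArg (fun a => (s : ℝ) • v a) (IccExtend_val zero_le_one y s).symm).trans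
      (eq_primitiveCLM_of_hasDerivWithinAt
      (g := fun r => r • v (IccExtend zero_le_one y r)) (by simp) (fun s => ?_) s)
    have hvy := (hv (y s)).comp_hasDerivWithinAt_of_eq (s : ℝ) (hy_deriv s)
      (IccExtend_val zero_le_one y s).symm
    refine ((hasDerivWithinAt_id (s : ℝ) (Icc 0 1)).smul hvy).congr_deriv ?_
    simp [z, smul_comm t, add_comm]
  let K := primitiveCLM E ∘L pointwiseApply _ E E (v'.comp y)
  have hfixed : w - z = t • K (w - z) := by
    conv_lhs => rw [hw, hz]
    simp [K, smul_sub]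
  have hwz : ‖w - z‖ ≤ ‖t‖ * ‖K‖ * ‖w - z‖ :=
    calc ‖w - z‖ = ‖t‖ * ‖K (w - z)‖ := (congrArg norm hfixed).trans (norm_smul _ _)
      _ ≤ ‖t‖ * ‖K‖ * ‖w - z‖ := by
        rw [mul_assoc]
        gcongr
        exact K.le_opNorm _
  have hzero : ‖w - z‖ = 0 := by nlinarith [norm_nonneg (w - z)]
  rw [sub_eq_zero.1 (norm_eq_zero.1 hzero)]
  simp [z]

theorem exists_picardResidual_eq_zero {v : C(E, E)} (hv : ContDiff ℝ ∞ v) (x₀ : E) :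
    ∃ Y : ℝ × E → C(Icc (0 : ℝ) 1, E), ∀ᶠ z in 𝓝 ((0 : ℝ), x₀),
      ContDiffAt ℝ ∞ Y z ∧ picardResidual v (z, Y z) = 0 := by
  let c : C(Icc (0 : ℝ) 1, E) := ContinuousMap.const _ x₀
  have hpartial : HasFDerivAt (fun y => picardResidual v ((0, x₀), y))
      (ContinuousLinearEquiv.refl ℝ C(Icc (0 : ℝ) 1, E) :
        C(Icc (0 : ℝ) 1, E) →L[ℝ] C(Icc (0 : ℝ) 1, E)) c := by
    simpa [picardResidual] using (hasFDerivAt_id c).sub_const (ContinuousMap.const _ x₀)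
  obtain ⟨Y, -, hY⟩ := exists_contDiffAt_implicitFunction (a := ((0 : ℝ), x₀))
    (Eventually.of_forall fun q => (contDiff_picardResidual hv).contDiffAt) hpartial
  have hc : picardResidual v (((0 : ℝ), x₀), c) = 0 := by
    ext s
    simp [picardResidual, c]
  exact ⟨Y, hc ▸ hY⟩

/- The implicit function theorem solves `picardResidual v (z, y) = 0` for the whole curve `y`, and
so makes the solution depend smoothly on `z`. -/
theorem exists_isSmoothLocalFlowAt_of_contDiff {v : E → E}
    (hv : ContDiff ℝ ∞ v) (x₀ : E) : ∃ Φ : ℝ × E → E, IsSmoothLocalFlowAt v Φ x₀ := by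
  let V : C(E, E) := ⟨v, hv.continuous⟩
  let V' : C(E, E →L[ℝ] E) := ⟨fderiv ℝ v, hv.continuous_fderiv (by simp)⟩
  have hV : ∀ x, HasFDerivAt V (V' x) x :=
    fun x => ((hv.differentiable (by simp)) x).hasFDerivAt
  obtain ⟨Y, hY⟩ := exists_picardResidual_eq_zero (v := V) hv x₀
  let eval₁ : C(Icc (0 : ℝ) 1, E) →L[ℝ] E := ContinuousMap.evalCLM ℝ 1
  have hsmooth : ∀ᶠ z in 𝓝 ((0 : ℝ), x₀), ContDiffAt ℝ ∞ (fun z => eval₁ (Y z)) z :=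
    hY.mono fun z hz => eval₁.contDiff.contDiffAt.comp z hz.1
  refine ⟨fun z => eval₁ (Y z), hsmooth, ?_, ?_⟩
  · have hslice : ContinuousAt (fun x : E => ((0 : ℝ), x)) x₀ := by fun_prop
    filter_upwards [hslice.eventually hY] with x hx
    simpa [picardResidual, sub_eq_zero, eval₁] using DFunLike.congr_fun hx.2 1
  · filter_upwards [hY.eventually_nhds,
      eventually_norm_variation_lt_one V' hY.self_of_nhds.1.continuousAt] with z hz hsmall
    have hpath : HasDerivAt (fun t : ℝ => ((t, z.2) : ℝ × E)) (1, 0) z.1 :=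
      (hasDerivAt_id _).prodMk (hasDerivAt_const _ _)
    have hY_deriv : HasDerivAt (fun t => Y (t, z.2)) (fderiv ℝ Y z (1, 0)) z.1 :=
      (hz.self_of_nhds.1.differentiableAt (by simp)).hasFDerivAt.comp_hasDerivAt z.1 hpath
    have hvelocity : eval₁ (fderiv ℝ Y z (1, 0)) = v (eval₁ (Y z)) :=
      apply_one_eq_of_variation hV hz.self_of_nhds.2
        (eq_variation_of_hasDerivAt hV (hz.mono fun _ h => h.2) hY_deriv) hsmall
    rw [← hvelocity]
    exact eval₁.hasFDerivAt.comp_hasDerivAt z.1 hY_deriv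

end Flow

section LocalFlow

variable {E : Type*} [NormedAddCommGroup E] [NormedSpace ℝ E]

theorem exists_contDiff_eventuallyEq [HasContDiffBump E] {F : Type*} [NormedAddCommGroup F]
    [NormedSpace ℝ F] {v : E → F} {x₀ : E} (hv : ∀ᶠ x in 𝓝 x₀, ContDiffAt ℝ ∞ v x) :
    ∃ w : E → F, ContDiff ℝ ∞ w ∧ w =ᶠ[𝓝 x₀] v := by
  obtain ⟨r, hr, hball⟩ := Metric.eventually_nhds_iff_ball.1 hv
  let χ : ContDiffBump x₀ := ⟨r / 4, r / 2, by positivity, by linarith⟩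
  refine ⟨fun x => χ x • v x, contDiff_iff_contDiffAt.2 fun x => ?_,
    χ.eventuallyEq_one.mono fun x hx => by simp [hx]⟩
  by_cases hx : x ∈ ball x₀ r
  · exact χ.contDiff.contDiffAt.smul (hball x hx)
  · have hxχ : x ∉ closedBall x₀ (r / 2) := fun h =>
      hx (closedBall_subset_ball (half_lt_self hr) h)
    refine contDiffAt_const (c := (0 : F)).congr_of_eventuallyEq ?_
    filter_upwards [isClosed_closedBall.isOpen_compl.mem_nhds hxχ] with y hy
    rw [χ.zero_of_le_dist (not_le.1 fun h => hy h).le, zero_smul]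

namespace IsSmoothLocalFlowAt

variable {v : E → E} {Φ : ℝ × E → E} {x₀ : E}

theorem apply_zero (h : IsSmoothLocalFlowAt v Φ x₀) : Φ (0, x₀) = x₀ :=
  h.initial.self_of_nhds

theorem tendsto (h : IsSmoothLocalFlowAt v Φ x₀) : Tendsto Φ (𝓝 (0, x₀)) (𝓝 x₀) := by
  simpa only [ContinuousAt, h.apply_zero] using h.contDiffAt.self_of_nhds.continuousAt

theorem congr (h : IsSmoothLocalFlowAt v Φ x₀) {w : E → E} (hvw : v =ᶠ[𝓝 x₀] w) :
    IsSmoothLocalFlowAt w Φ x₀ where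
  contDiffAt := h.contDiffAt
  initial := h.initial
  hasDerivAt := by
    filter_upwards [h.hasDerivAt, h.tendsto.eventually hvw] with z hz hzvw
    rwa [← hzvw]

theorem hasFDerivAt (h : IsSmoothLocalFlowAt v Φ x₀) :
    HasFDerivAt Φ ((ContinuousLinearMap.toSpanSingleton ℝ (v x₀)).coprod (.id ℝ E)) (0, x₀) := by
  have hΦ := (h.contDiffAt.self_of_nhds.differentiableAt (by simp)).hasFDerivAt
  have htime : fderiv ℝ Φ (0, x₀) (1, 0) = v x₀ := by
    have hpath : HasDerivAt (fun t : ℝ => ((t, x₀) : ℝ × E)) (1, 0) 0 :=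
      (hasDerivAt_id _).prodMk (hasDerivAt_const _ _)
    simpa only [h.apply_zero] using
      (hΦ.comp_hasDerivAt (0 : ℝ) hpath).unique h.hasDerivAt.self_of_nhds
  have hspace : fderiv ℝ Φ (0, x₀) ∘L .inr ℝ ℝ E = .id ℝ E :=
    (hΦ.comp x₀ (hasFDerivAt_prodMk_right 0 x₀)).unique
      ((hasFDerivAt_id x₀).congr_of_eventuallyEq h.initial)
  refine hΦ.congr_fderiv ?_
  ext ξ
  · simpa using htime
  · simpa using DFunLike.congr_fun hspace ξ

theorem eventually_apply_eq {f : E → ℝ} (h : IsSmoothLocalFlowAt v Φ x₀)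
    (hf : ∀ᶠ x in 𝓝 x₀, DifferentiableAt ℝ f x) (hvf : ∀ᶠ x in 𝓝 x₀, fderiv ℝ f x (v x) = 0) :
    ∀ᶠ z in 𝓝 ((0 : ℝ), x₀), f (Φ z) = f z.2 := by
  obtain ⟨r, hr, hball⟩ := Metric.eventually_nhds_iff_ball.1
    ((h.tendsto.eventually (hf.and hvf)).and
      (h.hasDerivAt.and (continuousAt_snd.eventually h.initial)))
  filter_upwards [Metric.ball_mem_nhds ((0 : ℝ), x₀) hr] with z hz
  rw [← ball_prod_same] at hz hball
  have hderiv : ∀ t ∈ ball (0 : ℝ) r, HasDerivAt (fun t => f (Φ (t, z.2))) 0 t := by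
    intro t ht
    obtain ⟨⟨hft, hvft⟩, hΦt, -⟩ := hball (t, z.2) ⟨ht, hz.2⟩
    exact hvft ▸ hft.hasFDerivAt.comp_hasDerivAt t hΦt
  have hconst := isOpen_ball.is_const_of_deriv_eq_zero (convex_ball (0 : ℝ) r).isPreconnected
    (fun t ht => (hderiv t ht).differentiableAt.differentiableWithinAt)
    (fun t ht => (hderiv t ht).deriv) hz.1 (mem_ball_self hr)
  simpa [(hball (0, z.2) ⟨mem_ball_self hr, hz.2⟩).2.2] using hconst

end IsSmoothLocalFlowAt

theorem exists_isSmoothLocalFlowAt [CompleteSpace E] [HasContDiffBump E] {v : E → E} {x₀ : E}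
    (hv : ∀ᶠ x in 𝓝 x₀, ContDiffAt ℝ ∞ v x) : ∃ Φ : ℝ × E → E, IsSmoothLocalFlowAt v Φ x₀ := by
  obtain ⟨w, hw, hwv⟩ := exists_contDiff_eventuallyEq hv
  obtain ⟨Φ, hΦ⟩ := exists_isSmoothLocalFlowAt_of_contDiff hw x₀
  exact ⟨Φ, hΦ.congr hwv⟩

end LocalFlow

section LinearAlgebra

theorem exists_apply_eq_one_apply_ne_zero {K V : Type*} [Field K] [AddCommGroup V] [Module K V]
    {β γ : Module.Dual K V} (hβ : β ≠ 0) (hγ : γ ≠ 0) : ∃ u, β u = 1 ∧ γ u ≠ 0 := by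
  obtain ⟨b, hb⟩ := LinearMap.surjective hβ 1
  obtain ⟨c, hc⟩ := LinearMap.surjective hγ 1
  by_cases hγb : γ b = 0
  · by_cases hβc : β c = 0
    · exact ⟨b + c, by simp [hb, hβc], by simp [hγb, hc]⟩
    · exact ⟨(β c)⁻¹ • c, by simp [hβc], by simp [hc, hβc]⟩
  · exact ⟨b, hb, hγb⟩

/- First move `x` to `y`; a dilatransvection fixing `y` then corrects the functional. -/
theorem exists_continuousLinearEquiv_apply_eq_and_comp_eq {E : Type*} [NormedAddCommGroup E]
    [NormedSpace ℝ E] [FiniteDimensional ℝ E] {x y : E} {α β : Module.Dual ℝ E} (hx : x ≠ 0)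
    (hy : y ≠ 0) (hα : α ≠ 0) (hβ : β ≠ 0) (hαx : α x = 0) (hβy : β y = 0) :
    ∃ T : E ≃L[ℝ] E, T x = y ∧ ∀ z, β (T z) = α z := by
  obtain ⟨S, hS⟩ := SeparatingDual.exists_continuousLinearEquiv_apply_eq (R := ℝ) hx hy
  let γ : Module.Dual ℝ E := α ∘ₗ S.symm.toLinearMap
  have hγ : γ ≠ 0 := fun h => hα <| LinearMap.ext fun z => by
    simpa [γ] using LinearMap.congr_fun h (S z)
  have hγy : γ y = 0 := by simp [γ, ← hS, hαx]
  obtain ⟨u, hβu, hγu⟩ := exists_apply_eq_one_apply_ne_zero hβ hγ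
  have hunit : IsUnit (1 + (γ - β) u) := by simpa [hβu] using hγu
  refine ⟨S.trans (LinearEquiv.dilatransvection hunit).toContinuousLinearEquiv, ?_, fun z => ?_⟩
  · simp [LinearEquiv.dilatransvection, LinearMap.transvection, hS, hγy, hβy]
  · simp [LinearEquiv.dilatransvection, LinearMap.transvection, hβu, γ]

end LinearAlgebra

section Straightening

variable {E : Type*} [NormedAddCommGroup E] [NormedSpace ℝ E] [CompleteSpace E]

theorem exists_linearizing_map {f : E → ℝ} {x₀ : E} (hf : ∀ᶠ x in 𝓝 x₀, ContDiffAt ℝ ∞ f x)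
    (hf₀ : fderiv ℝ f x₀ ≠ 0) :
    ∃ σ : E → E, σ 0 = x₀ ∧ HasFDerivAt σ (.id ℝ E) 0 ∧
      ∀ᶠ y in 𝓝 0, ContDiffAt ℝ ∞ σ y ∧ f (σ y) = f x₀ + fderiv ℝ f x₀ y := by
  let α := fderiv ℝ f x₀
  obtain ⟨b, hb⟩ : ∃ b, α b = 1 :=
    LinearMap.surjective (f := α.toLinearMap) (by exact_mod_cast hf₀) 1
  let χ : E → E := fun x => (x - x₀) + (f x - f x₀ - α (x - x₀)) • b
  have hχ : ∀ᶠ x in 𝓝 x₀, ContDiffAt ℝ ∞ χ x := hf.mono fun x hx => by fun_prop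
  have hχ₀ : χ x₀ = 0 := by simp [χ]
  have hαχ : ∀ x, α (χ x) = f x - f x₀ := fun x => by simp [χ, hb]
  have hχ_deriv : HasFDerivAt χ (ContinuousLinearEquiv.refl ℝ E : E →L[ℝ] E) x₀ := by
    have hfα := (hf.self_of_nhds.differentiableAt (by simp)).hasFDerivAt
    have hsub := (hasFDerivAt_id (𝕜 := ℝ) x₀).sub_const x₀
    refine (hsub.add (((hfα.sub_const (f x₀)).sub
      (α.hasFDerivAt.comp x₀ hsub)).smul_const b)).congr_fderiv ?_
    ext y
    simp [α]
  obtain ⟨e, hx₀, he, -, -, hsymm⟩ := exists_openPartialHomeomorph_contDiffAt hχ hχ_deriv univ_mem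
  have h0 : (0 : E) ∈ e.target := by simpa [he, hχ₀] using e.map_source hx₀
  have hσ₀ : e.symm 0 = x₀ := by simpa [he, hχ₀] using e.left_inv hx₀
  have hσ_deriv : HasFDerivAt e.symm ((ContinuousLinearEquiv.refl ℝ E).symm : E →L[ℝ] E) 0 :=
    e.hasFDerivAt_symm h0 (by rwa [hσ₀, he])
  refine ⟨e.symm, hσ₀, hσ_deriv, ?_⟩
  filter_upwards [e.open_target.mem_nhds h0] with y hy
  have hright : χ (e.symm y) = y := by simpa only [he] using e.right_inv hy
  exact ⟨hsymm y hy, by rw [← sub_eq_iff_eq_add', ← hαχ, hright]⟩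

/- Flow from the slice `β = 0`, parametrized so that `f` is affine on it. -/
theorem exists_straightening_map [HasContDiffBump E] {v : E → E} {f : E → ℝ} {x₀ : E}
    (hv : ∀ᶠ x in 𝓝 x₀, ContDiffAt ℝ ∞ v x) (hf : ∀ᶠ x in 𝓝 x₀, ContDiffAt ℝ ∞ f x)
    (hvf : ∀ᶠ x in 𝓝 x₀, fderiv ℝ f x (v x) = 0) (hv₀ : v x₀ ≠ 0) (hf₀ : fderiv ℝ f x₀ ≠ 0) :
    ∃ Ψ : E → E, Ψ 0 = x₀ ∧ HasFDerivAt Ψ (.id ℝ E) 0 ∧ ∀ᶠ y in 𝓝 0, ContDiffAt ℝ ∞ Ψ y ∧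
      fderiv ℝ Ψ y (v x₀) = v (Ψ y) ∧ f (Ψ y) = f x₀ + fderiv ℝ f x₀ y := by
  obtain ⟨Φ, hΦ⟩ := exists_isSmoothLocalFlowAt hv
  obtain ⟨σ, hσ₀, hσ_deriv, hσ⟩ := exists_linearizing_map hf hf₀
  obtain ⟨β, hβ⟩ := SeparatingDual.exists_eq_one (R := ℝ) hv₀
  let π : E →L[ℝ] E := .id ℝ E - β.smulRight (v x₀)
  have hπ_line : ∀ y (t : ℝ), π (y + t • v x₀) = π y := fun y t => by simp [π, hβ, add_smul]
  let Q : E → ℝ × E := fun y => (β y, σ (π y))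
  have hQ₀ : Q 0 = (0, x₀) := by simp [Q, hσ₀]
  have hQ_deriv : HasFDerivAt Q (β.prod π) 0 := by
    refine β.hasFDerivAt.prodMk ?_
    exact HasFDerivAt.comp (0 : E) (by rwa [map_zero]) π.hasFDerivAt
  have hQ_tendsto : Tendsto Q (𝓝 0) (𝓝 (0, x₀)) := hQ₀ ▸ hQ_deriv.continuousAt
  have hπσ : ∀ᶠ y in 𝓝 0, ContDiffAt ℝ ∞ σ (π y) ∧ f (σ (π y)) = f x₀ + fderiv ℝ f x₀ (π y) :=
    (π.continuous.tendsto' 0 0 (map_zero π)).eventually hσ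
  refine ⟨Φ ∘ Q, by simp [hQ₀, hΦ.apply_zero], ?_, ?_⟩
  · refine ((hQ₀ ▸ hΦ.hasFDerivAt).comp 0 hQ_deriv).congr_fderiv ?_
    ext y
    simp [π]
  have hfΦ := hΦ.eventually_apply_eq (hf.mono fun x hx => hx.differentiableAt (by simp)) hvf
  filter_upwards [hπσ, hQ_tendsto.eventually hΦ.contDiffAt, hQ_tendsto.eventually hΦ.hasDerivAt,
    hQ_tendsto.eventually hfΦ] with y ⟨hσy, hfσy⟩ hΦy hΦy_deriv hfΦy
  have hΨy : ContDiffAt ℝ ∞ (Φ ∘ Q) y :=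
    hΦy.comp y (β.contDiff.contDiffAt.prodMk (hσy.comp y π.contDiff.contDiffAt))
  refine ⟨hΨy, ?_, ?_⟩
  · have hline := (hΨy.differentiableAt (by simp)).hasFDerivAt.hasLineDerivAt (v x₀)
    have hline_flow : (fun t : ℝ => (Φ ∘ Q) (y + t • v x₀)) = fun t => Φ (β y + t, σ (π y)) := by
      funext t
      simp [Q, hπ_line, hβ]
    rw [HasLineDerivAt, hline_flow] at hline
    refine hline.unique ?_
    simpa using HasDerivAt.comp_const_add (β y) 0 (by simpa [Q] using hΦy_deriv)
  · rw [Function.comp_apply, hfΦy]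
    simpa [Q, π, hvf.self_of_nhds] using hfσy

theorem exists_straightening_openPartialHomeomorph [FiniteDimensional ℝ E] {v : E → E} {f : E → ℝ}
    {x₀ : E} (hv : ∀ᶠ x in 𝓝 x₀, ContDiffAt ℝ ∞ v x) (hf : ∀ᶠ x in 𝓝 x₀, ContDiffAt ℝ ∞ f x)
    (hvf : ∀ᶠ x in 𝓝 x₀, fderiv ℝ f x (v x) = 0) (hv₀ : v x₀ ≠ 0) (hf₀ : fderiv ℝ f x₀ ≠ 0)
    {s : Set E} (hs : s ∈ 𝓝 x₀) {e : E} {α : E →L[ℝ] ℝ} (he : e ≠ 0) (hα : α ≠ 0)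
    (hαe : α e = 0) :
    ∃ Ψ : OpenPartialHomeomorph E E, x₀ ∈ Ψ.target ∧ Ψ.target ⊆ s ∧
      (∀ x ∈ Ψ.target, ContDiffAt ℝ ∞ Ψ.symm x) ∧
      ∀ y ∈ Ψ.source, ContDiffAt ℝ ∞ Ψ y ∧ fderiv ℝ Ψ y e = v (Ψ y) ∧ f (Ψ y) = f x₀ + α y := by
  obtain ⟨T, hTe, hTα⟩ := exists_continuousLinearEquiv_apply_eq_and_comp_eq (α := α.toLinearMap)
    (β := (fderiv ℝ f x₀).toLinearMap) he hv₀ (by exact_mod_cast hα) (by exact_mod_cast hf₀) hαe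
    hvf.self_of_nhds
  obtain ⟨Ψ, hΨ₀, hΨ_deriv, hΨ⟩ := exists_straightening_map hv hf hvf hv₀ hf₀
  have hT : Tendsto T (𝓝 0) (𝓝 0) := T.continuous.tendsto' 0 0 (map_zero T)
  have hΨT_deriv : HasFDerivAt (Ψ ∘ T) (T : E →L[ℝ] E) 0 := by
    exact HasFDerivAt.comp (0 : E) (by rwa [map_zero]) T.hasFDerivAt
  have hΨT_s : ∀ᶠ y in 𝓝 0, Ψ (T y) ∈ s :=
    hΨT_deriv.continuousAt.tendsto.eventually (by simpa [hΨ₀] using hs)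
  obtain ⟨Θ, h0, hΘ, hgood, hsmooth, hsymm⟩ := exists_openPartialHomeomorph_contDiffAt
    ((hT.eventually hΨ).mono fun y hy => hy.1.comp y T.contDiff.contDiffAt) hΨT_deriv
    ((hT.eventually hΨ).and hΨT_s)
  refine ⟨Θ, by simpa [hΘ, hΨ₀] using Θ.map_source h0, fun x hx => ?_, hsymm, fun y hy => ?_⟩
  · have hright : Ψ (T (Θ.symm x)) = x := by
      simpa only [hΘ, Function.comp_apply] using Θ.right_inv hx
    exact hright ▸ (hgood (Θ.map_target hx)).2
  · obtain ⟨⟨hΨy, hvy, hfy⟩, -⟩ := hgood hy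
    rw [hΘ]
    refine ⟨hsmooth y hy, ?_, hTα y ▸ hfy⟩
    rw [fderiv_comp y (hΨy.differentiableAt (by simp)) T.differentiableAt, T.fderiv]
    simpa [hTe] using hvy

end Straightening

section StraighteningChart

variable {E : Type*} [NormedAddCommGroup E] [NormedSpace ℝ E]
  {M : Type*} [TopologicalSpace M] [ChartedSpace E M]

theorem mdifferentiable_of_mem_maximalAtlas {φ : OpenPartialHomeomorph M E}
    (hφ : φ ∈ IsManifold.maximalAtlas 𝓘(ℝ, E) ∞ M) : φ.MDifferentiable 𝓘(ℝ, E) 𝓘(ℝ, E) :=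
  ⟨(contMDiffOn_of_mem_maximalAtlas hφ).mdifferentiableOn (by simp),
    (contMDiffOn_symm_of_mem_maximalAtlas hφ).mdifferentiableOn (by simp)⟩

theorem isInvertible_mfderiv_symm {φ : OpenPartialHomeomorph M E}
    (hφ : φ ∈ IsManifold.maximalAtlas 𝓘(ℝ, E) ∞ M) {x : E} (hx : x ∈ φ.target) :
    (mfderiv 𝓘(ℝ, E) 𝓘(ℝ, E) φ.symm x).IsInvertible :=
  ⟨(mdifferentiable_of_mem_maximalAtlas hφ).symm.mfderiv hx, rfl⟩

theorem mfderiv_symm_mpullback {φ : OpenPartialHomeomorph M E}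
    (hφ : φ ∈ IsManifold.maximalAtlas 𝓘(ℝ, E) ∞ M) {x : E} (hx : x ∈ φ.target)
    (N : (p : M) → TangentSpace 𝓘(ℝ, E) p) :
    mfderiv 𝓘(ℝ, E) 𝓘(ℝ, E) φ.symm x (VectorField.mpullback 𝓘(ℝ, E) 𝓘(ℝ, E) φ.symm N x) =
      N (φ.symm x) :=
  (isInvertible_mfderiv_symm hφ hx).self_apply_inverse _

theorem mpullback_symm_ne_zero {φ : OpenPartialHomeomorph M E}
    (hφ : φ ∈ IsManifold.maximalAtlas 𝓘(ℝ, E) ∞ M) {x : E} (hx : x ∈ φ.target)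
    {N : (p : M) → TangentSpace 𝓘(ℝ, E) p} (hN : N (φ.symm x) ≠ 0) :
    VectorField.mpullback 𝓘(ℝ, E) 𝓘(ℝ, E) φ.symm N x ≠ 0 := fun h =>
  hN <| by rw [← mfderiv_symm_mpullback hφ hx N, h]; exact map_zero _

theorem fderiv_comp_symm {φ : OpenPartialHomeomorph M E}
    (hφ : φ ∈ IsManifold.maximalAtlas 𝓘(ℝ, E) ∞ M) {x : E} (hx : x ∈ φ.target) {f : M → ℝ}
    (hf : MDifferentiableAt 𝓘(ℝ, E) 𝓘(ℝ, ℝ) f (φ.symm x)) :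
    fderiv ℝ (f ∘ φ.symm) x =
      mfderiv 𝓘(ℝ, E) 𝓘(ℝ, ℝ) f (φ.symm x) ∘L mfderiv 𝓘(ℝ, E) 𝓘(ℝ, E) φ.symm x := by
  rw [← mfderiv_eq_fderiv]
  exact mfderiv_comp x hf ((mdifferentiable_of_mem_maximalAtlas hφ).mdifferentiableAt_symm hx)

theorem fderiv_comp_symm_ne_zero {φ : OpenPartialHomeomorph M E}
    (hφ : φ ∈ IsManifold.maximalAtlas 𝓘(ℝ, E) ∞ M) {x : E} (hx : x ∈ φ.target) {f : M → ℝ}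
    (hf : mfderiv 𝓘(ℝ, E) 𝓘(ℝ, ℝ) f (φ.symm x) ≠ 0) : fderiv ℝ (f ∘ φ.symm) x ≠ 0 := by
  intro h
  rw [fderiv_comp_symm hφ hx (not_imp_comm.1 mfderiv_zero_of_not_mdifferentiableAt hf)] at h
  refine hf (ContinuousLinearMap.ext fun X => ?_)
  obtain ⟨Y, rfl⟩ := (mdifferentiable_of_mem_maximalAtlas hφ).symm.mfderiv_surjective hx X
  exact DFunLike.congr_fun h Y

variable [IsManifold 𝓘(ℝ, E) ∞ M]

theorem trans_mem_maximalAtlas {φ : OpenPartialHomeomorph M E}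
    (hφ : φ ∈ IsManifold.maximalAtlas 𝓘(ℝ, E) ∞ M) {χ : OpenPartialHomeomorph E E}
    (hχ : ∀ x ∈ χ.source, ContDiffAt ℝ ∞ χ x) (hχ_symm : ∀ y ∈ χ.target, ContDiffAt ℝ ∞ χ.symm y) :
    φ.trans χ ∈ IsManifold.maximalAtlas 𝓘(ℝ, E) ∞ M := by
  refine (φ.trans χ).mem_maximalAtlas_of_contMDiffOn (fun q hq => ?_) (fun y hy => ?_)
  · obtain ⟨hqφ, hqχ⟩ : q ∈ φ.source ∧ φ q ∈ χ.source := by simpa using hq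
    exact ((hχ _ hqχ).contMDiffAt.comp q
      (contMDiffAt_of_mem_maximalAtlas hφ hqφ)).contMDiffWithinAt
  · obtain ⟨hyχ, hyφ⟩ : y ∈ χ.target ∧ χ.symm y ∈ φ.target := by simpa using hy
    exact ((contMDiffAt_symm_of_mem_maximalAtlas hφ hyφ).comp y
      (hχ_symm y hyχ).contMDiffAt).contMDiffWithinAt

theorem contDiffAt_mpullback_symm [CompleteSpace E] {N : (p : M) → TangentSpace 𝓘(ℝ, E) p}
    {φ : OpenPartialHomeomorph M E} (hφ : φ ∈ IsManifold.maximalAtlas 𝓘(ℝ, E) ∞ M) {x : E}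
    (hx : x ∈ φ.target)
    (hN : ContMDiffAt 𝓘(ℝ, E) 𝓘(ℝ, E).tangent ∞
      (fun p => (⟨p, N p⟩ : TangentBundle 𝓘(ℝ, E) M)) (φ.symm x)) :
    ContDiffAt ℝ ∞ (VectorField.mpullback 𝓘(ℝ, E) 𝓘(ℝ, E) φ.symm N) x :=
  contMDiffAt_vectorSpace_iff_contDiffAt.1 <|
    hN.mpullback_vectorField_preimage (contMDiffAt_symm_of_mem_maximalAtlas hφ hx)
      (isInvertible_mfderiv_symm hφ hx) (by simp)

theorem exists_straightening_chart [FiniteDimensional ℝ E] {U : Set M} (hU : IsOpen U) {f : M → ℝ}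
    (hf : ContMDiffOn 𝓘(ℝ, E) 𝓘(ℝ, ℝ) ∞ f U) {N : (p : M) → TangentSpace 𝓘(ℝ, E) p}
    (hN : ContMDiffOn 𝓘(ℝ, E) 𝓘(ℝ, E).tangent ∞
      (fun p => (⟨p, N p⟩ : TangentBundle 𝓘(ℝ, E) M)) U)
    (hfN : ∀ q ∈ U, mfderiv 𝓘(ℝ, E) 𝓘(ℝ, ℝ) f q (N q) = 0) {p : M} (hp : p ∈ U) (hNp : N p ≠ 0)
    (hfp : mfderiv 𝓘(ℝ, E) 𝓘(ℝ, ℝ) f p ≠ 0) {e : E} {α : E →L[ℝ] ℝ} (he : e ≠ 0) (hα : α ≠ 0)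
    (hαe : α e = 0) :
    ∃ φ ∈ IsManifold.maximalAtlas 𝓘(ℝ, E) ∞ M, p ∈ φ.source ∧ φ.source ⊆ U ∧ ∀ y ∈ φ.target,
      N (φ.symm y) = mfderiv 𝓘(ℝ, E) 𝓘(ℝ, E) φ.symm y e ∧ f (φ.symm y) = f p + α y := by
  let κ := chartAt E p
  have hκ : κ ∈ IsManifold.maximalAtlas 𝓘(ℝ, E) ∞ M := IsManifold.chart_mem_maximalAtlas p
  have hpκ : κ.symm (κ p) = p := κ.left_inv (mem_chart_source E p)
  let v : E → E := VectorField.mpullback 𝓘(ℝ, E) 𝓘(ℝ, E) κ.symm N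
  let s : Set E := κ.target ∩ κ.symm ⁻¹' U
  have hps : κ p ∈ s := ⟨mem_chart_target E p, by rwa [mem_preimage, hpκ]⟩
  have hs : s ∈ 𝓝 (κ p) := (κ.isOpen_inter_preimage_symm hU).mem_nhds hps
  have hfU : ∀ q ∈ U, ContMDiffAt 𝓘(ℝ, E) 𝓘(ℝ, ℝ) ∞ f q := fun q hq =>
    hf.contMDiffAt (hU.mem_nhds hq)
  have hv : ∀ᶠ x in 𝓝 (κ p), ContDiffAt ℝ ∞ v x := eventually_of_mem hs fun x hx =>
    contDiffAt_mpullback_symm hκ hx.1 (hN.contMDiffAt (hU.mem_nhds hx.2))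
  have hfκ : ∀ᶠ x in 𝓝 (κ p), ContDiffAt ℝ ∞ (f ∘ κ.symm) x := eventually_of_mem hs fun x hx =>
    ((hfU _ hx.2).comp x (contMDiffAt_symm_of_mem_maximalAtlas hκ hx.1)).contDiffAt
  have hvf : ∀ᶠ x in 𝓝 (κ p), fderiv ℝ (f ∘ κ.symm) x (v x) = 0 := by
    filter_upwards [hs] with x hx
    rw [fderiv_comp_symm hκ hx.1 ((hfU _ hx.2).mdifferentiableAt (by simp))]
    exact (congrArg _ (mfderiv_symm_mpullback hκ hx.1 N)).trans (hfN _ hx.2)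
  obtain ⟨Ψ, hpΨ, hΨs, hΨsymm, hΨ⟩ := exists_straightening_openPartialHomeomorph hv hfκ hvf
    (mpullback_symm_ne_zero hκ hps.1 (by rwa [hpκ]))
    (fderiv_comp_symm_ne_zero hκ hps.1 (by rwa [hpκ])) hs he hα hαe
  refine ⟨κ.trans Ψ.symm, trans_mem_maximalAtlas hκ hΨsymm fun y hy => (hΨ y hy).1, ?_,
    fun q hq => ?_, fun y hy => ?_⟩
  · simpa [κ] using hpΨ
  · obtain ⟨hqκ, hqΨ⟩ : q ∈ κ.source ∧ κ q ∈ Ψ.target := by simpa using hq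
    exact κ.left_inv hqκ ▸ (hΨs hqΨ).2
  · obtain ⟨hyΨ, hyκ⟩ : y ∈ Ψ.source ∧ Ψ y ∈ κ.target := by simpa using hy
    obtain ⟨hΨy, hvy, hfy⟩ := hΨ y hyΨ
    refine ⟨?_, by simpa [hpκ] using hfy⟩
    have hcomp := mfderiv_comp y
      ((mdifferentiable_of_mem_maximalAtlas hκ).mdifferentiableAt_symm hyκ)
      (hΨy.contMDiffAt.mdifferentiableAt (by simp))
    calc N (κ.symm (Ψ y)) = mfderiv 𝓘(ℝ, E) 𝓘(ℝ, E) κ.symm (Ψ y) (fderiv ℝ Ψ y e) := by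
          rw [hvy]; exact (mfderiv_symm_mpullback hκ hyκ N).symm
      _ = mfderiv 𝓘(ℝ, E) 𝓘(ℝ, E) (κ.symm ∘ Ψ) y e := by
          rw [hcomp, mfderiv_eq_fderiv]; rfl

end StraighteningChart

section LorentzianForm

variable {V : Type*} [AddCommGroup V] [Module ℝ V] {B : LinearMap.BilinForm ℝ V}

theorem apply_self_neg_of_apply_basis_eq_diagonal {ι : Type*} [Finite ι] [DecidableEq ι]
    (b : Module.Basis ι ℝ V) {d : ι → ℝ} (hb : ∀ i j, B (b i) (b j) = Matrix.diagonal d i j)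
    {i₀ : ι} (hd₀ : d i₀ ≠ 0) (hd : ∀ i ≠ i₀, d i < 0) {w : V} (hw : B (b i₀) w = 0)
    (hw₀ : w ≠ 0) : B w w < 0 := by
  have := Fintype.ofFinite ι
  have hBw : ∀ i, B (b i) w = d i * b.repr w i := fun i => by
    calc B (b i) w = B (b i) (∑ j, b.repr w j • b j) := by rw [b.sum_repr]
      _ = d i * b.repr w i := by
        rw [map_sum]
        simp [hb, Matrix.diagonal_apply, mul_comm]
  have hBww : B w w = ∑ i, d i * b.repr w i ^ 2 :=
    calc B w w = B (∑ i, b.repr w i • b i) w := by rw [b.sum_repr]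
      _ = ∑ i, b.repr w i * (d i * b.repr w i) := by
        simp only [map_sum, map_smul, LinearMap.sum_apply, LinearMap.smul_apply, hBw, smul_eq_mul]
      _ = ∑ i, d i * b.repr w i ^ 2 := Finset.sum_congr rfl fun i _ => by ring
  have hwi₀ : b.repr w i₀ = 0 := by simpa [hBw, hd₀] using hw
  obtain ⟨i, hi⟩ : ∃ i, b.repr w i ≠ 0 := by
    by_contra! h
    exact hw₀ (b.ext_elem fun i => by simpa using h i)
  have hii₀ : i ≠ i₀ := fun h => hi (h ▸ hwi₀)
  rw [hBww]
  refine Finset.sum_neg' (fun j _ => ?_) ⟨i, Finset.mem_univ i, ?_⟩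
  · rcases eq_or_ne j i₀ with rfl | hj
    · simp [hwi₀]
    · exact mul_nonpos_of_nonpos_of_nonneg (hd j hj).le (sq_nonneg _)
  · exact mul_neg_of_neg_of_pos (hd i hii₀) (sq_pos_of_ne_zero hi)

variable {t v : V}

theorem apply_ne_zero_of_null (ht : ∀ w, B t w = 0 → w ≠ 0 → B w w < 0) (hv : v ≠ 0)
    (hvv : B v v = 0) : B t v ≠ 0 :=
  fun h => (ht v h hv).ne hvv

/- The combination of `v` and `w` in the orthogonal complement of `t` has the same square as a
multiple of `w`. -/
theorem apply_self_neg_of_orthogonal_null (hB : B.IsSymm)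
    (ht : ∀ w, B t w = 0 → w ≠ 0 → B w w < 0) (hv : v ≠ 0) (hvv : B v v = 0) {w : V}
    (hvw : B v w = 0) (hw : w ∉ Submodule.span ℝ {v}) : B w w < 0 := by
  have htv := apply_ne_zero_of_null ht hv hvv
  have hwv : B w v = 0 := by rw [← hvw]; exact hB.eq w v
  have hne : B t v • w - B t w • v ≠ 0 := fun h => hw <| Submodule.mem_span_singleton.2
    ⟨(B t v)⁻¹ * B t w, by rw [mul_smul, ← sub_eq_zero.1 h, inv_smul_smul₀ htv]⟩
  have hneg := ht _ (by simp; ring) hne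
  have hsq : B (B t v • w - B t w • v) (B t v • w - B t w • v) = B t v ^ 2 * B w w := by
    simp [hvv, hvw, hwv]
    ring
  rw [hsq] at hneg
  exact neg_of_mul_neg_right hneg (sq_nonneg _)

theorem posDef_neg_gram_of_orthogonal_null (hB : B.IsSymm)
    (ht : ∀ w, B t w = 0 → w ≠ 0 → B w w < 0) (hvv : B v v = 0) {ι : Type*} [Finite ι]
    {b : ι → V} (hvb : ∀ i, B v (b i) = 0) (hb : LinearIndependent ℝ b)
    (hv : v ∉ Submodule.span ℝ (range b)) : (-Matrix.of fun i j => B (b i) (b j)).PosDef := by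
  have := Fintype.ofFinite ι
  have hv₀ : v ≠ 0 := fun h => hv (h ▸ zero_mem _)
  refine Matrix.PosDef.of_dotProduct_mulVec_pos ?_ fun x hx => ?_
  · ext i j
    simpa using hB.eq (b j) (b i)
  let w := ∑ i, x i • b i
  have hw₀ : w ≠ 0 := fun h => hx <| funext <| Fintype.linearIndependent_iff.1 hb x h
  have hwb : w ∈ Submodule.span ℝ (range b) :=
    Submodule.sum_mem _ fun i _ => Submodule.smul_mem _ _ (Submodule.subset_span ⟨i, rfl⟩)
  have hwv : w ∉ Submodule.span ℝ {v} := fun h => by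
    obtain ⟨c, hc⟩ := Submodule.mem_span_singleton.1 h
    have hc₀ : c ≠ 0 := by rintro rfl; exact hw₀ (by rw [← hc, zero_smul])
    exact hv ((Submodule.smul_mem_iff _ hc₀).1 (hc ▸ hwb))
  have hquad : star x ⬝ᵥ (-Matrix.of fun i j => B (b i) (b j)) *ᵥ x = -B w w := by
    simp [w, dotProduct, Matrix.mulVec, Finset.mul_sum, mul_comm,
      fun i j => hB.eq (b i) (b j)]
  rw [hquad, neg_pos]
  exact apply_self_neg_of_orthogonal_null hB ht hv₀ hvv (by simp [w, hvb]) hwv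

end LorentzianForm

section FundamentalTensor

theorem deriv_deriv_eq_fderiv_fderiv {E : Type*} [NormedAddCommGroup E] [NormedSpace ℝ E]
    {F : E → ℝ} {v : E} (hF : ContDiffAt ℝ 2 F v) (u w : E) :
    deriv (fun s : ℝ => deriv (fun t : ℝ => F (v + t • u + s • w)) 0) 0 =
      fderiv ℝ (fderiv ℝ F) v w u := by
  have hF' : DifferentiableAt ℝ (fderiv ℝ F) v :=
    (hF.fderiv_right (m := 1) (by norm_num)).differentiableAt (by simp)
  have hev : (fun x => lineDeriv ℝ F x u) =ᶠ[𝓝 v] fun x => fderiv ℝ F x u :=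
    (hF.eventually (by simp)).mono fun x hx =>
      (hx.differentiableAt (by simp)).lineDeriv_eq_fderiv
  calc deriv (fun s : ℝ => deriv (fun t : ℝ => F (v + t • u + s • w)) 0) 0
      = lineDeriv ℝ (fun x => lineDeriv ℝ F x u) v w := by
        simp only [lineDeriv, add_right_comm]
    _ = lineDeriv ℝ (fun x => fderiv ℝ F x u) v w := hev.lineDeriv_eq
    _ = fderiv ℝ (fun x => fderiv ℝ F x u) v w :=
        (hF'.clm_apply (differentiableAt_const u)).lineDeriv_eq_fderiv
    _ = fderiv ℝ (fderiv ℝ F) v w u := by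
        simp [fderiv_clm_apply hF' (differentiableAt_const u)]

variable {M : Type*} [TopologicalSpace M] [ChartedSpace R4 M]

theorem fundTensor_neg (L : TangentBundle (𝓡 4) M → ℝ) {p : M} (v u w : TangentSpace (𝓡 4) p) :
    fundTensor (-L) v u w = -fundTensor L v u w := by
  simp only [fundTensor, Pi.neg_apply, deriv.fun_neg, mul_neg]

theorem fundTensor_self {L : TangentBundle (𝓡 4) M → ℝ} {p : M} {v : TangentSpace (𝓡 4) p}
    (hL : ∀ c : ℝ, 0 < c → L ⟨p, c • v⟩ = c ^ 2 * L ⟨p, v⟩) :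
    fundTensor L v v v = L ⟨p, v⟩ := by
  have hquad : ∀ᶠ z : ℝ × ℝ in 𝓝 0,
      L ⟨p, v + z.2 • v + z.1 • v⟩ = (1 + z.2 + z.1) ^ 2 * L ⟨p, v⟩ := by
    have hpos : ∀ᶠ z : ℝ × ℝ in 𝓝 0, 0 < 1 + z.2 + z.1 :=
      (by fun_prop : Continuous fun z : ℝ × ℝ => 1 + z.2 + z.1).continuousAt.eventually
        (Ioi_mem_nhds (by simp))
    filter_upwards [hpos] with z hz
    rw [← hL _ hz, add_smul, add_smul, one_smul]
  have hderiv : (fun s : ℝ => deriv (fun t : ℝ => L ⟨p, v + t • v + s • v⟩) 0) =ᶠ[𝓝 0]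
      fun s => 2 * (1 + s) * L ⟨p, v⟩ := by
    filter_upwards [hquad.curry_nhds] with s hs
    have hsq : HasDerivAt (fun t : ℝ => (1 + t + s) ^ 2) (2 * (1 + s)) 0 := by
      simpa using (((hasDerivAt_id (0 : ℝ)).const_add 1).add_const s).fun_pow 2
    rw [EventuallyEq.deriv_eq hs, (hsq.mul_const _).deriv]
  rw [fundTensor, hderiv.deriv_eq]
  simp

theorem exists_bilinForm_eq_fundTensor {L : TangentBundle (𝓡 4) M → ℝ} {p : M}
    {v : TangentSpace (𝓡 4) p} (hL : ContDiffAt ℝ 2 (fun u : R4 => L ⟨p, u⟩) v) :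
    ∃ B : LinearMap.BilinForm ℝ (TangentSpace (𝓡 4) p), B.IsSymm ∧
      ∀ u w, fundTensor L v u w = B u w := by
  let F : R4 → ℝ := fun u => L ⟨p, u⟩
  let D : R4 →L[ℝ] R4 →L[ℝ] ℝ := fderiv ℝ (fderiv ℝ F) v
  have hD : ∀ u w, D u w = D w u := hL.isSymmSndFDerivAt (by simp)
  let B : LinearMap.BilinForm ℝ R4 := (1 / 2 : ℝ) • D.toBilinForm
  refine ⟨B, ⟨fun u w => ?_⟩, fun u w => ?_⟩
  · exact congrArg ((1 / 2 : ℝ) * ·) (hD u w)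
  · exact congrArg ((1 / 2 : ℝ) * ·) ((deriv_deriv_eq_fderiv_fderiv hL u w).trans (hD w u))

variable [IsManifold (𝓡 4) ∞ M]

theorem contMDiff_tangentBundle_mk (p : M) :
    ContMDiff 𝓘(ℝ, R4) (𝓡 4).tangent ∞ fun v : R4 => (⟨p, v⟩ : TangentBundle (𝓡 4) M) := by
  intro v
  refine Bundle.contMDiffAt_totalSpace.2 ⟨contMDiffAt_const, ?_⟩
  let e := trivializationAt R4 (fun x : M => TangentSpace (𝓡 4) x) p
  have he : (fun v : R4 => (e ⟨p, v⟩).2) = (e.continuousLinearMapAt ℝ p : R4 →L[ℝ] R4) :=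
    (e.coe_linearMapAt_of_mem (R := ℝ) (FiberBundle.mem_baseSet_trivializationAt' p)).symm
  change ContMDiffAt 𝓘(ℝ, R4) 𝓘(ℝ, R4) ∞ (fun v : R4 => (e ⟨p, v⟩).2) v
  rw [he]
  exact (ContinuousLinearMap.contDiff _).contMDiff.contMDiffAt

/-- `L` is a Lorentz–Finsler metric at the single vector `v`: along the tangent space it is twice
continuously differentiable at `v`, it is positively homogeneous of degree two along the ray of
`v`, and `g_v` has signature `(+,-,-,-)`. -/
structure IsLorentzFinslerAt (L : TangentBundle (𝓡 4) M → ℝ) {p : M} (v : TangentSpace (𝓡 4) p) :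
    Prop where
  contDiffAt : ContDiffAt ℝ 2 (fun u : R4 => L ⟨p, u⟩) v
  homogeneous : ∀ c : ℝ, 0 < c → L ⟨p, c • v⟩ = c ^ 2 * L ⟨p, v⟩
  signature : HasSignaturePMMM L v

theorem IsFinslerSpacetime.isLorentzFinslerAt {A : Set (TangentBundle (𝓡 4) M)}
    {L : TangentBundle (𝓡 4) M → ℝ} (h : IsFinslerSpacetime A L) {p : M}
    {v : TangentSpace (𝓡 4) p} (hv : (⟨p, v⟩ : TangentBundle (𝓡 4) M) ∈ slitClosure A) :
    IsLorentzFinslerAt L v where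
  contDiffAt := by
    obtain ⟨O, hO, hAO, hL⟩ := h.smooth
    have hLv : ContMDiffAt (𝓡 4).tangent 𝓘(ℝ, ℝ) ∞ L ⟨p, v⟩ :=
      hL.contMDiffAt (hO.mem_nhds (hAO hv))
    have hfibre : ContMDiffAt 𝓘(ℝ, R4) 𝓘(ℝ, ℝ) ∞ (fun u : R4 => L ⟨p, u⟩) v :=
      hLv.comp (M := R4) v (contMDiff_tangentBundle_mk p (v : R4))
    exact hfibre.contDiffAt.of_le ENat.LEInfty.out
  homogeneous c hc := h.homogeneous p v c hc hv
  signature := h.signature p v hv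

end FundamentalTensor

section LightlikeChart

variable {M : Type*} [TopologicalSpace M] [ChartedSpace R4 M]

theorem coordVec_symm_apply {φ : OpenPartialHomeomorph M R4} {y : R4} (hy : y ∈ φ.target)
    (i : Fin 4) :
    coordVec φ i (φ.symm y) =
      mfderiv (𝓡 4) (𝓡 4) φ.symm y (EuclideanSpace.single i (1 : ℝ)) :=
  congrArg (fun z => (mfderiv (𝓡 4) (𝓡 4) φ.symm z (EuclideanSpace.single i (1 : ℝ)) : R4))
    (φ.right_inv hy)

theorem linearIndependent_coordVec {φ : OpenPartialHomeomorph M R4}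
    (hφ : φ ∈ IsManifold.maximalAtlas (𝓡 4) ∞ M) {q : M} (hq : q ∈ φ.source) :
    LinearIndependent ℝ fun i => coordVec φ i q := by
  have hinj := (mdifferentiable_of_mem_maximalAtlas hφ).symm.mfderiv_injective (φ.map_source hq)
  have hli := (EuclideanSpace.basisFun (Fin 4) ℝ).toBasis.linearIndependent
  simpa [Function.comp_def] using! hli.map' _ (LinearMap.ker_eq_bot.2 hinj)

theorem metricMatrix_neg (L : TangentBundle (𝓡 4) M → ℝ) (N : (p : M) → TangentSpace (𝓡 4) p)
    (φ : OpenPartialHomeomorph M R4) (q : M) :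
    metricMatrix (-L) N φ q = -metricMatrix L N φ q :=
  Matrix.ext fun _ _ => fundTensor_neg L _ _ _

theorem transverseBlock_eq_submatrix (G : Matrix (Fin 4) (Fin 4) ℝ) :
    transverseBlock G = G.submatrix ![2, 3] ![2, 3] := by
  ext i j
  fin_cases i <;> fin_cases j <;> rfl

variable {L : TangentBundle (𝓡 4) M → ℝ}

theorem IsLorentzFinslerAt.exists_bilinForm {p : M} {v : TangentSpace (𝓡 4) p}
    (h : IsLorentzFinslerAt L v) :
    ∃ B : LinearMap.BilinForm ℝ (TangentSpace (𝓡 4) p), B.IsSymm ∧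
      (∀ u w, fundTensor L v u w = B u w) ∧ ∃ t, ∀ w, B t w = 0 → w ≠ 0 → B w w < 0 := by
  obtain ⟨B, hB, hLB⟩ := exists_bilinForm_eq_fundTensor h.contDiffAt
  obtain ⟨b, hb⟩ := h.signature
  refine ⟨B, hB, hLB, b 0, fun w => apply_self_neg_of_apply_basis_eq_diagonal b (i₀ := 0)
    (fun i j => by rw [← hLB, hb]) (by simp) fun i hi => ?_⟩
  fin_cases i <;> simp_all

theorem IsLorentzFinslerAt.exists_fundTensor_ne_zero {p : M} {v : TangentSpace (𝓡 4) p}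
    (h : IsLorentzFinslerAt L v) (hv : v ≠ 0) (hLv : L ⟨p, v⟩ = 0) :
    ∃ X, fundTensor L v v X ≠ 0 := by
  obtain ⟨B, hB, hLB, t, ht⟩ := h.exists_bilinForm
  have hvv : B v v = 0 := by rw [← hLB, fundTensor_self h.homogeneous, hLv]
  exact ⟨t, by rw [hLB, ← hB.eq]; exact apply_ne_zero_of_null ht hv hvv⟩

variable {N : (p : M) → TangentSpace (𝓡 4) p}

theorem posDef_neg_transverseBlock {φ : OpenPartialHomeomorph M R4}
    (hφ : φ ∈ IsManifold.maximalAtlas (𝓡 4) ∞ M) {q : M} (hq : q ∈ φ.source)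
    (hL : IsLorentzFinslerAt L (N q)) (hLN : L ⟨q, N q⟩ = 0) (hN : N q = coordVec φ 0 q)
    (h₂ : metricMatrix L N φ q 0 2 = 0) (h₃ : metricMatrix L N φ q 0 3 = 0) :
    (-transverseBlock (metricMatrix L N φ q)).PosDef := by
  obtain ⟨B, hB, hLB, t, ht⟩ := hL.exists_bilinForm
  have hNN : B (N q) (N q) = 0 := by rw [← hLB, fundTensor_self hL.homogeneous, hLN]
  have hli := linearIndependent_coordVec hφ hq
  let j : Fin 2 → Fin 4 := ![2, 3]
  have hNj : ∀ k, B (N q) (coordVec φ (j k) q) = 0 := by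
    rw [metricMatrix, Matrix.of_apply, ← hN, hLB] at h₂ h₃
    exact Fin.forall_fin_two.2 ⟨h₂, h₃⟩
  have hspan : N q ∉ Submodule.span ℝ (range fun k => coordVec φ (j k) q) := by
    rw [hN, range_comp' (fun i => coordVec φ i q) j]
    exact hli.notMem_span_image (by simp [j])
  have hgram := posDef_neg_gram_of_orthogonal_null hB ht hNN hNj
    (hli.comp j (by decide)) hspan
  rw [transverseBlock_eq_submatrix]
  convert hgram using 2
  ext k l
  exact hLB _ _

variable {U : Set M}

theorem IsLightlikeChart.metricMatrix_zero_apply {p : M} {φ : OpenPartialHomeomorph M R4}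
    (h : IsLightlikeChart L U N p φ) {q : M} (hq : q ∈ φ.source) (j : Fin 4) :
    metricMatrix L N φ q 0 j = if j = 1 then 1 else 0 := by
  rw [h.matrix_eq q hq]
  fin_cases j <;> rfl

variable [IsManifold (𝓡 4) ∞ M] {f : M → ℝ}

theorem exists_coordVec_chart (hU : IsOpen U) (hf : ContMDiffOn (𝓡 4) 𝓘(ℝ, ℝ) ∞ f U)
    (hN : ContMDiffOn (𝓡 4) (𝓡 4).tangent ∞ (fun p => (⟨p, N p⟩ : TangentBundle (𝓡 4) M)) U)
    (hfN : ∀ q ∈ U, mfderiv (𝓡 4) 𝓘(ℝ, ℝ) f q (N q) = 0) {p : M} (hp : p ∈ U) (hNp : N p ≠ 0)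
    (hfp : mfderiv (𝓡 4) 𝓘(ℝ, ℝ) f p ≠ 0) :
    ∃ φ ∈ IsManifold.maximalAtlas (𝓡 4) ∞ M, p ∈ φ.source ∧ φ.source ⊆ U ∧
      ∀ q ∈ φ.source, N q = coordVec φ 0 q ∧
        ∀ i, mfderiv (𝓡 4) 𝓘(ℝ, ℝ) f q (coordVec φ i q) = if i = 1 then (1 : ℝ) else 0 := by
  let e : R4 := EuclideanSpace.single 0 1
  let α : R4 →L[ℝ] ℝ := EuclideanSpace.proj 1
  have he : e ≠ 0 := fun h => one_ne_zero (congrFun (congrArg WithLp.ofLp h) 0)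
  have hα : α ≠ 0 := fun h => by simpa [α] using DFunLike.congr_fun h (EuclideanSpace.single 1 1)
  obtain ⟨φ, hφ, hpφ, hφU, hφNf⟩ :=
    exists_straightening_chart hU hf hN hfN hp hNp hfp he hα (by simp [e, α])
  refine ⟨φ, hφ, hpφ, hφU, fun q hq => ?_⟩
  obtain ⟨y, hy, rfl⟩ : ∃ y ∈ φ.target, φ.symm y = q := ⟨φ q, φ.map_source hq, φ.left_inv hq⟩
  refine ⟨(hφNf y hy).1.trans (coordVec_symm_apply hy 0).symm, fun i => ?_⟩
  have hfφ : f ∘ φ.symm =ᶠ[𝓝 y] fun z => f p + α z :=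
    (φ.open_target.eventually_mem hy).mono fun z hz => (hφNf z hz).2
  have hdf : fderiv ℝ (f ∘ φ.symm) y = α := by
    rw [hfφ.fderiv_eq, fderiv_const_add, α.fderiv]
  have hfq := (hf.contMDiffAt (hU.mem_nhds (hφU hq))).mdifferentiableAt (by simp)
  rw [fderiv_comp_symm hφ hy hfq] at hdf
  rw [coordVec_symm_apply hy]
  exact (DFunLike.congr_fun hdf (EuclideanSpace.single i 1)).trans (by simp [α, eq_comm])

theorem exists_isLightlikeChart (hU : IsOpen U) (hf : ContMDiffOn (𝓡 4) 𝓘(ℝ, ℝ) ∞ f U)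
    (hN : ContMDiffOn (𝓡 4) (𝓡 4).tangent ∞ (fun p => (⟨p, N p⟩ : TangentBundle (𝓡 4) M)) U)
    (hgrad : ∀ q ∈ U, ∀ X, fundTensor L (N q) (N q) X = mfderiv (𝓡 4) 𝓘(ℝ, ℝ) f q X)
    (hlight : IsLightlikeOn L U N)
    (hsmooth : ∀ q ∈ U, ContDiffAt ℝ 2 (fun u : R4 => L ⟨q, u⟩) (N q))
    (hhom : ∀ q ∈ U, ∀ c : ℝ, 0 < c → L ⟨q, c • N q⟩ = c ^ 2 * L ⟨q, N q⟩) {p : M} (hp : p ∈ U)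
    (hnondeg : ∃ X, fundTensor L (N p) (N p) X ≠ 0) :
    ∃ φ : OpenPartialHomeomorph M R4, IsLightlikeChart L U N p φ := by
  have hfN : ∀ q ∈ U, mfderiv (𝓡 4) 𝓘(ℝ, ℝ) f q (N q) = 0 := fun q hq => by
    rw [← hgrad q hq, fundTensor_self (hhom q hq), (hlight q hq).2]
    rfl
  have hfp : mfderiv (𝓡 4) 𝓘(ℝ, ℝ) f p ≠ 0 := fun h => by
    obtain ⟨X, hX⟩ := hnondeg
    exact hX ((hgrad p hp X).trans (by rw [h]; rfl))
  obtain ⟨φ, hφ, hpφ, hφU, hφNf⟩ := exists_coordVec_chart hU hf hN hfN hp (hlight p hp).1 hfp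
  refine ⟨φ, hφ, hpφ, hφU, fun q hq => (hφNf q hq).1, fun q hq => ?_⟩
  have hrow : ∀ i, metricMatrix L N φ q 0 i = if i = 1 then (1 : ℝ) else 0 := fun i => by
    rw [← (hφNf q hq).2 i, ← hgrad q (hφU hq), metricMatrix, Matrix.of_apply, ← (hφNf q hq).1]
  have hsymm : ∀ i j, metricMatrix L N φ q i j = metricMatrix L N φ q j i := fun i j => by
    obtain ⟨B, hB, hLB⟩ := exists_bilinForm_eq_fundTensor (hsmooth q (hφU hq))
    rw [metricMatrix, Matrix.of_apply, Matrix.of_apply, hLB, hLB, ← hB.eq]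
  ext i j
  fin_cases i <;> fin_cases j <;> simp [hrow, hsymm _ 0]

end LightlikeChart

theorem lemma3p1_general {M : Type*} [TopologicalSpace M] [ChartedSpace R4 M]
    [IsManifold (𝓡 4) ∞ M] (L : TangentBundle (𝓡 4) M → ℝ) (U : Set M) (hU : IsOpen U)
    (f : M → ℝ) (hf : ContMDiffOn (𝓡 4) 𝓘(ℝ, ℝ) ∞ f U) (N : (p : M) → TangentSpace (𝓡 4) p)
    (hN : ContMDiffOn (𝓡 4) (𝓡 4).tangent ∞ (fun p => (⟨p, N p⟩ : TangentBundle (𝓡 4) M)) U)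
    (hgrad : ∀ q ∈ U, ∀ X, fundTensor L (N q) (N q) X = mfderiv (𝓡 4) 𝓘(ℝ, ℝ) f q X)
    (hlight : IsLightlikeOn L U N) :
    ((∀ q ∈ U, IsLorentzFinslerAt L (N q)) → ∀ p ∈ U, ∃ φ : OpenPartialHomeomorph M R4,
      IsLightlikeChart L U N p φ ∧
        ∀ q ∈ φ.source, (-transverseBlock (metricMatrix L N φ q)).PosDef) ∧
    ((∀ q ∈ U, IsLorentzFinslerAt (-L) (N q)) → ∀ p ∈ U, ∃ φ : OpenPartialHomeomorph M R4,
      IsLightlikeChart L U N p φ ∧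
        ∀ q ∈ φ.source, (transverseBlock (metricMatrix L N φ q)).PosDef) := by
  refine ⟨fun hL p hp => ?_, fun hL p hp => ?_⟩
  · obtain ⟨φ, hφ⟩ := exists_isLightlikeChart hU hf hN hgrad hlight
      (fun q hq => (hL q hq).contDiffAt) (fun q hq => (hL q hq).homogeneous) hp
      ((hL p hp).exists_fundTensor_ne_zero (hlight p hp).1 (hlight p hp).2)
    refine ⟨φ, hφ, fun q hq => ?_⟩
    have hqU := hφ.source_subset hq
    exact posDef_neg_transverseBlock hφ.mem_atlas hq (hL q hqU) (hlight q hqU).2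
      (hφ.field_eq q hq) (by simp [hφ.metricMatrix_zero_apply hq])
      (by simp [hφ.metricMatrix_zero_apply hq])
  · have hneg : ∀ q ∈ U, (-L) ⟨q, N q⟩ = 0 := fun q hq => by simp [(hlight q hq).2]
    obtain ⟨φ, hφ⟩ := exists_isLightlikeChart hU hf hN hgrad hlight
      (fun q hq => by simpa using! (hL q hq).contDiffAt.neg)
      (fun q hq => by simpa using (hL q hq).homogeneous) hp
      (by simpa [fundTensor_neg] using
        (hL p hp).exists_fundTensor_ne_zero (hlight p hp).1 (hneg p hp))
    refine ⟨φ, hφ, fun q hq => ?_⟩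
    have hqU := hφ.source_subset hq
    have hpos := posDef_neg_transverseBlock hφ.mem_atlas hq (hL q hqU) (hneg q hqU)
      (hφ.field_eq q hq) (by simp [metricMatrix_neg, hφ.metricMatrix_zero_apply hq])
      (by simp [metricMatrix_neg, hφ.metricMatrix_zero_apply hq])
    simpa only [metricMatrix_neg, transverseBlock_eq_submatrix, Matrix.submatrix_neg,
      Pi.neg_apply, neg_neg] using hpos

/-- Lightlike coordinates, in both signature conventions. The first part is for `L ≥ 0` on `Ā` and
`g` of signature `(+,-,-,-)`; the transverse block is then negative definite. The second part is
for `L ≤ 0` on `Ā` and `g` of signature `(-,+,+,+)`, that is, `-L` is as in the first part;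
the transverse block is then positive definite. In each part the gradient and the matrix are
those of `L` itself. -/
theorem lemma3p1 {M : Type*} [TopologicalSpace M] [ChartedSpace R4 M] [IsManifold (𝓡 4) ∞ M]
    (A : Set (TangentBundle (𝓡 4) M)) (L : TangentBundle (𝓡 4) M → ℝ)
    (U : Set M) (hU : IsOpen U) (f : M → ℝ) (hf : ContMDiffOn (𝓡 4) 𝓘(ℝ, ℝ) ∞ f U)
    (N : (p : M) → TangentSpace (𝓡 4) p)
    (hgrad : IsGradientOn A L f U N) (hlight : IsLightlikeOn L U N) :
    (IsFinslerSpacetime A L → ∀ p ∈ U, ∃ φ : OpenPartialHomeomorph M R4,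
      IsLightlikeChart L U N p φ ∧
        ∀ q ∈ φ.source, (-transverseBlock (metricMatrix L N φ q)).PosDef) ∧
    (IsFinslerSpacetime A (-L) → ∀ p ∈ U, ∃ φ : OpenPartialHomeomorph M R4,
      IsLightlikeChart L U N p φ ∧
        ∀ q ∈ φ.source, (transverseBlock (metricMatrix L N φ q)).PosDef) :=
  (lemma3p1_general L U hU f hf N hgrad.smooth hgrad.metric_eq hlight).imp
    (fun h hL => h fun q hq => hL.isLorentzFinslerAt (hgrad.admissible q hq))
    (fun h hL => h fun q hq => hL.isLorentzFinslerAt (hgrad.admissible q hq))
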